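/- Let $u\colon\mathbb N\to\mathbb C$ be a bounded arithmetic function ($\mathbb N=\{1,2,\dots\}$; $\sum_{n\le N}$ means $\sum_{1\le n\le N}$). A topological system $(X,T)$ is a homeomorphism $T$ of a compact metric space $X$. Write $u\perp(X,T)$ if $\lim_{N\to\infty}\frac1N\sum_{n\le N}f(T^nx)u(n)=0$ for all $f\in C(X)$ and $x\in X$, and, for a class $\mathscr C$ of topological systems, $u\perp\mathscr C$ if $u\perp(X,T)$ for every $(X,T)\in\mathscr C$. For an increasing sequence $(N_k)$ of positive integers, $x\in X$ is generic along $(N_k)$ for a Borel probability measure $\nu$ on $X$ if $\frac1{N_k}\sum_{n\le N_k}\delta_{T^nx}\to\nu$ weakly; $\nu$ is visible if this holds for some $x$ and some $(N_k)$. Let $\mathscr C_{\mathrm{ID}}$ be the class of topological systems $(X,T)$ such that $T=\mathrm{id}$ $\nu$-almost everywhere for every visible measure $\nu$. It is also described as the class of topological systems whose only ergodic probability measures are Dirac measures at fixed points. Extend $u$ to $\mathbb Z$ by $u(-n)=u(n)$ and an arbitrary value $u(0)\in\mathbb C$, let $S$ be the left shift on $\mathbb C^{\mathbb Z}$ and let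 $X_u$ be the closure of $\{S^mu:m\in\mathbb Z\}$ in the product topology (a compact set). An increasing sequence $(N_k)$ defines a Furstenberg system of $u$ if, in $(X_u,S)$, the point $u$ is generic along $(N_k)$ for some Borel probability measure on $X_u$. Then $u\perp\mathscr C_{\mathrm{ID}}$ (with either description of $\mathscr C_{\mathrm{ID}}$) if and only if for each $\varepsilon>0$ and each increasing sequence $(N_k)$ defining a Furstenberg system of $u$ there exists $H_0\ge1$ such that for each integer $H\ge H_0$ the following limit exists and satisfies $$\lim_{k\to\infty}\frac1{N_k}\sum_{n\le N_k}\left|\frac1H\sum_{h\le H}u(n+h)\right|^2\le\varepsilon .$$ -/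

import Mathlib

open MeasureTheory Filter Topology
open scoped NNReal

/-- A topological dynamical system: a homeomorphism `T` of a compact metric space `X`
(carrying its Borel σ-algebra). -/
structure TopSystem where
  X : Type
  [metric : MetricSpace X]
  [compact : CompactSpace X]
  [meas : MeasurableSpace X]
  [borel : BorelSpace X]
  T : X ≃ₜ X

attribute [instance] TopSystem.metric TopSystem.compact TopSystem.meas TopSystem.borel

/-- The empirical measure `(1/N) ∑_{1 ≤ n ≤ N} δ_{T^n x}`. -/
noncomputable def empiricalMeasure {X : Type} [MeasurableSpace X] (T : X → X) (x : X) (N : ℕ) :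
    FiniteMeasure X :=
  (N : ℝ≥0)⁻¹ • ∑ n ∈ Finset.Icc 1 N, (diracProba (T^[n] x)).toFiniteMeasure

/-- `x` is generic for the probability measure `ν` along `(N k)`: the empirical measures
`(1/N_k) ∑_{1 ≤ n ≤ N_k} δ_{T^n x}` converge weakly to `ν`. -/
def IsGenericAlong {X : Type} [TopologicalSpace X] [MeasurableSpace X] [OpensMeasurableSpace X]
    (T : X → X) (x : X) (N : ℕ → ℕ) (ν : ProbabilityMeasure X) : Prop :=
  Tendsto (fun k => empiricalMeasure T x (N k)) atTop (𝓝 ν.toFiniteMeasure)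

/-- `ν` is a visible measure of the system: some point is generic for `ν` along some
increasing sequence. -/
def TopSystem.IsVisible (Y : TopSystem) (ν : ProbabilityMeasure Y.X) : Prop :=
  ∃ (x : Y.X) (N : ℕ → ℕ), StrictMono N ∧ IsGenericAlong Y.T x N ν

/-- The class of systems each of whose visible measures yields an identity
(i.e. `T` is almost everywhere the identity map). -/
def classID : Set TopSystem :=
  {Y | ∀ ν : ProbabilityMeasure Y.X, Y.IsVisible ν → ∀ᵐ x ∂(ν : Measure Y.X), Y.T x = x}

/-- The class of systems whose only ergodic probability measures are the Dirac measures
at fixed points. -/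
def classErgodicFixed : Set TopSystem :=
  {Y | ∀ ν : ProbabilityMeasure Y.X, Ergodic Y.T (ν : Measure Y.X) →
    ∃ p : Y.X, Y.T p = p ∧ (ν : Measure Y.X) = Measure.dirac p}

/-- `u ⊥ (X, T)`: for all `f ∈ C(X)` and all `x ∈ X`,
`(1/N) ∑_{1 ≤ n ≤ N} f(T^n x) u(n) → 0`. -/
def OrthogonalToSystem (u : ℕ → ℂ) (Y : TopSystem) : Prop :=
  ∀ (f : C(Y.X, ℂ)) (x : Y.X),
    Tendsto (fun N : ℕ => (1 / (N : ℂ)) * ∑ n ∈ Finset.Icc 1 N, f (Y.T^[n] x) * u n)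
      atTop (𝓝 0)

/-- `u ⊥ 𝒞`: orthogonality to every system of the class. -/
def OrthogonalToClass (u : ℕ → ℂ) (C : Set TopSystem) : Prop :=
  ∀ Y ∈ C, OrthogonalToSystem u Y

/-- The symmetric extension of `u` to `ℤ`, `u(-n) = u(n)`; the arbitrary value at `0` is `u 0`. -/
def extendToInt (u : ℕ → ℂ) : ℤ → ℂ := fun k => u k.natAbs

/-- The left shift on two-sided complex sequences. -/
noncomputable def leftShift : (ℤ → ℂ) ≃ₜ (ℤ → ℂ) where
  toFun z := fun k => z (k + 1)
  invFun z := fun k => z (k - 1)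
  left_inv z := by funext k; simp
  right_inv z := by funext k; simp
  continuous_toFun := by fun_prop
  continuous_invFun := by fun_prop

/-- The subshift `X_u`: the closure of the two-sided orbit `{S^m u : m ∈ ℤ}` of the extended
sequence, in the product topology. For `|u| ≤ L` it lies in `{|z| ≤ L}^ℤ` and is compact. -/
def orbitClosure (u : ℕ → ℂ) : Set (ℤ → ℂ) :=
  closure (Set.range fun m : ℤ => fun k : ℤ => extendToInt u (k + m))

theorem leftShift_image_orbit (u : ℕ → ℂ) :
    leftShift '' (Set.range fun m : ℤ => fun k : ℤ => extendToInt u (k + m)) =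
      Set.range fun m : ℤ => fun k : ℤ => extendToInt u (k + m) := by
  ext z
  constructor
  · rintro ⟨_, ⟨m, rfl⟩, rfl⟩
    refine ⟨m + 1, ?_⟩
    funext k
    change extendToInt u (k + (m + 1)) = extendToInt u (k + 1 + m)
    congr 1
    ring
  · rintro ⟨m, rfl⟩
    refine ⟨_, ⟨m - 1, rfl⟩, ?_⟩
    funext k
    change extendToInt u (k + 1 + (m - 1)) = extendToInt u (k + m)
    congr 1
    ring

theorem mem_orbitClosure_iff_leftShift (u : ℕ → ℂ) (z : ℤ → ℂ) :
    z ∈ orbitClosure u ↔ leftShift z ∈ orbitClosure u := by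
  have h : leftShift '' orbitClosure u = orbitClosure u := by
    rw [orbitClosure, leftShift.image_closure, leftShift_image_orbit]
  constructor
  · intro hz
    rw [← h]
    exact Set.mem_image_of_mem _ hz
  · intro hz
    rw [← h] at hz
    exact leftShift.injective.mem_set_image.mp hz

/-- The shift `S` restricted to the subshift `X_u`. -/
noncomputable def subshiftMap (u : ℕ → ℂ) : orbitClosure u ≃ₜ orbitClosure u :=
  leftShift.subtype (mem_orbitClosure_iff_leftShift u)

/-- The extended sequence `u` as a point of its subshift `X_u`. -/
def subshiftPoint (u : ℕ → ℂ) : orbitClosure u :=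
  ⟨extendToInt u, subset_closure ⟨0, by simp⟩⟩

/-- The increasing sequence `(N k)` defines a Furstenberg system of `u`: the point `u ∈ X_u` is
generic along `(N k)` for some probability measure `κ` on `X_u`. -/
def DefinesFurstenbergSystem (u : ℕ → ℂ) (N : ℕ → ℕ) : Prop :=
  StrictMono N ∧ ∃ κ : ProbabilityMeasure (orbitClosure u),
    IsGenericAlong (subshiftMap u) (subshiftPoint u) N κ

/-- `(1/N) ∑_{1 ≤ n ≤ N} |(1/H) ∑_{1 ≤ h ≤ H} u(n+h)|²`. -/
noncomputable def shortIntervalMean (u : ℕ → ℂ) (H N : ℕ) : ℝ :=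
  (1 / (N : ℝ)) * ∑ n ∈ Finset.Icc 1 N,
    ‖(1 / (H : ℂ)) * ∑ h ∈ Finset.Icc 1 H, u (n + h)‖ ^ 2

/-- For each `ε > 0` and each sequence `(N k)` defining a Furstenberg system of `u` there is
`H₀ ≥ 1` such that for each `H ≥ H₀` the limit over `k` of the short interval means exists and
is at most `ε`. -/
def ShortIntervalCondition (u : ℕ → ℂ) : Prop :=
  ∀ ε : ℝ, 0 < ε → ∀ N : ℕ → ℕ, DefinesFurstenbergSystem u N →
    ∃ H₀ : ℕ, 1 ≤ H₀ ∧ ∀ H : ℕ, H₀ ≤ H →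
      ∃ l : ℝ, Tendsto (fun k => shortIntervalMean u H (N k)) atTop (𝓝 l) ∧ l ≤ ε

/-! Three implications close a cycle, so only the inclusion `classErgodicFixed ⊆ classID` is needed
between the two classes: orthogonality to `classID` gives orthogonality to `classErgodicFixed`,
which gives the short interval condition, which gives back orthogonality to `classID`.

The inclusion rests on `exists_ergodic_integral_ge`: if an invariant measure gave `dist (T y) y` a
positive integral, some ergodic measure would too.

From the condition to orthogonality: if `T` is the identity almost everywhere for the visible
measures, `f (T^n x)` hardly changes on average under a bounded shift of `n`. So `u` may be replaced
by its short averages (`norm_sum_mul_le`), which are small in mean square.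

Conversely, if the condition fails, overlapping windows of slowly growing length, weighted by the
conjugates of the averages of `u` over them, add up to a bounded sequence with increments tending to
zero that correlates with `u`. The subshift of such a sequence lies in `classErgodicFixed`, a
contradiction. -/

section Generic

/-! ### Empirical measures and generic points. -/

variable {X : Type} [TopologicalSpace X] [CompactSpace X] [MeasurableSpace X] [BorelSpace X]

theorem integral_empiricalMeasure (T : X → X) (x : X) (N : ℕ) {f : X → ℝ} (hf : Continuous f) :
    ∫ y, f y ∂(empiricalMeasure T x N : Measure X) =
      (1 / (N : ℝ)) * ∑ n ∈ Finset.Icc 1 N, f (T^[n] x) := by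
  have hint : ∀ μ : Measure X, IsFiniteMeasure μ → Integrable f μ := fun μ _ =>
    (BoundedContinuousFunction.mkOfCompact ⟨f, hf⟩).integrable μ
  rw [empiricalMeasure, FiniteMeasure.toMeasure_smul, integral_smul_nnreal_measure,
    FiniteMeasure.toMeasure_sum, integral_finsetSum_measure (fun i _ => hint _ inferInstance)]
  have : ∀ n : ℕ, ∫ y, f y ∂((diracProba (T^[n] x)).toFiniteMeasure : Measure X) = f (T^[n] x) :=
    fun n => integral_dirac' f _ (hf.measurable.stronglyMeasurable)
  rw [Finset.sum_congr rfl fun n _ => this n]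
  simp [NNReal.smul_def]

theorem IsGenericAlong.tendsto_average {T : X → X} {x : X} {N : ℕ → ℕ}
    {ν : ProbabilityMeasure X} (h : IsGenericAlong T x N ν) {f : X → ℝ} (hf : Continuous f) :
    Tendsto (fun k => (1 / (N k : ℝ)) * ∑ n ∈ Finset.Icc 1 (N k), f (T^[n] x)) atTop
      (𝓝 (∫ y, f y ∂(ν : Measure X))) := by
  have := (FiniteMeasure.tendsto_iff_forall_integral_tendsto.1 h)
    (BoundedContinuousFunction.mkOfCompact ⟨f, hf⟩)
  simpa [integral_empiricalMeasure T x _ hf] using this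

theorem IsGenericAlong.comp {X : Type} [TopologicalSpace X] [MeasurableSpace X]
    [OpensMeasurableSpace X] {T : X → X} {x : X} {N : ℕ → ℕ}
    {ν : ProbabilityMeasure X} (h : IsGenericAlong T x N ν) {φ : ℕ → ℕ} (hφ : StrictMono φ) :
    IsGenericAlong T x (N ∘ φ) ν :=
  Tendsto.comp h hφ.tendsto_atTop

theorem exists_isGenericAlong_subseq [TopologicalSpace.MetrizableSpace X] (T : X → X) (x : X)
    {N : ℕ → ℕ} (hN : StrictMono N) :
    ∃ φ : ℕ → ℕ, StrictMono φ ∧ ∃ ν : ProbabilityMeasure X, IsGenericAlong T x (N ∘ φ) ν := by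
  -- The index is shifted by one because `N 0` may be `0`, where the empirical measure is zero and
  -- not a probability measure.
  have hpos : ∀ k, 0 < N (k + 1) := fun k => (Nat.zero_le _).trans_lt (hN (Nat.lt_succ_self k))
  have hprob : ∀ k, IsProbabilityMeasure (empiricalMeasure T x (N (k + 1)) : Measure X) := by
    intro k
    have h0 : ((N (k + 1) : ℕ) : ℝ≥0) ≠ 0 := by exact_mod_cast (hpos k).ne'
    have : (empiricalMeasure T x (N (k + 1))).mass = 1 := by
      rw [FiniteMeasure.mass, empiricalMeasure]
      have : ∀ s : Finset ℕ, (∑ n ∈ s, (diracProba (T^[n] x)).toFiniteMeasure) Set.univ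
          = s.card := by
        intro s
        induction s using Finset.cons_induction with
        | empty => simp
        | cons a s ha ih =>
          rw [Finset.sum_cons, FiniteMeasure.coeFn_add, Pi.add_apply, ih, Finset.card_cons]
          simp [add_comm]
      rw [FiniteMeasure.smul_apply, this]
      simp [h0]
    constructor
    rw [← FiniteMeasure.ennreal_mass, this, ENNReal.coe_one]
  let P : ℕ → ProbabilityMeasure X := fun k => ⟨empiricalMeasure T x (N (k + 1)), hprob k⟩
  obtain ⟨ν, φ, hφ, hlim⟩ := CompactSpace.tendsto_subseq P
  refine ⟨fun k => φ k + 1, fun a b hab => Nat.succ_lt_succ (hφ hab), ν, ?_⟩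
  exact (ProbabilityMeasure.toFiniteMeasure_continuous.tendsto ν).comp hlim

/-- The averages of `f ∘ T` and `f` telescope: they differ by at most `2‖f‖ / N k`. -/
theorem IsGenericAlong.measurePreserving [TopologicalSpace.MetrizableSpace X] {T : X → X}
    (hT : Continuous T) {x : X} {N : ℕ → ℕ} (hN : StrictMono N)
    {ν : ProbabilityMeasure X} (h : IsGenericAlong T x N ν) :
    MeasurePreserving T (ν : Measure X) (ν : Measure X) := by
  refine ⟨hT.measurable, ?_⟩
  have : IsProbabilityMeasure ((ν : Measure X).map T) :=
    Measure.isProbabilityMeasure_map hT.measurable.aemeasurable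
  refine ext_of_forall_integral_eq_of_IsFiniteMeasure fun f => ?_
  rw [integral_map hT.measurable.aemeasurable f.continuous.aestronglyMeasurable]
  have h1 := h.tendsto_average (f.continuous.comp hT)
  have h2 := h.tendsto_average f.continuous
  have hNt : Tendsto (fun k => ((N k : ℕ) : ℝ)) atTop atTop :=
    tendsto_natCast_atTop_atTop.comp hN.tendsto_atTop
  have h3 : Tendsto (fun k => (2 * ‖f‖) * ((N k : ℝ))⁻¹) atTop (𝓝 0) := by
    simpa using (tendsto_inv_atTop_zero.comp hNt).const_mul (2 * ‖f‖)
  refine eq_of_sub_eq_zero (tendsto_nhds_unique (h1.sub h2) (squeeze_zero_norm (fun k => ?_) h3))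
  rw [← mul_sub, ← Finset.sum_sub_distrib]
  have htel : ∑ n ∈ Finset.Icc 1 (N k), ((f ∘ T) (T^[n] x) - f (T^[n] x)) =
      f (T^[N k + 1] x) - f (T^[1] x) := by
    have := Finset.sum_Ico_sub (fun n => f (T^[n] x)) (show 1 ≤ N k + 1 by lia)
    rw [← this]
    refine Finset.sum_congr (by ext; simp) fun n _ => ?_
    simp only [Function.comp_apply, Function.iterate_succ_apply']
  rw [htel, norm_mul, mul_comm, one_div, norm_inv, Real.norm_natCast]
  gcongr
  calc _ ≤ ‖f (T^[N k + 1] x)‖ + ‖f (T^[1] x)‖ := norm_sub_le _ _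
    _ ≤ ‖f‖ + ‖f‖ := add_le_add (f.norm_coe_le_norm _) (f.norm_coe_le_norm _)
    _ = _ := by ring

end Generic

/-! ### Ergodic measures from a maximum principle. -/

section Extreme

variable {X : Type} [TopologicalSpace X] [CompactSpace X] [TopologicalSpace.MetrizableSpace X]
  [MeasurableSpace X] [BorelSpace X]

theorem isClosed_setOf_measurePreserving {X : Type} [TopologicalSpace X]
    [TopologicalSpace.MetrizableSpace X] [MeasurableSpace X] [BorelSpace X] {T : X → X} (hT : Continuous T) :
    IsClosed {ν : ProbabilityMeasure X | MeasurePreserving T (ν : Measure X) (ν : Measure X)} := by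
  have : {ν : ProbabilityMeasure X | MeasurePreserving T (ν : Measure X) (ν : Measure X)} =
      {ν | ν.map hT.measurable.aemeasurable = ν} := by
    ext ν
    constructor
    · intro h
      exact Subtype.ext h.map_eq
    · intro h
      exact ⟨hT.measurable, congrArg Subtype.val h⟩
  rw [this]
  exact isClosed_eq (ProbabilityMeasure.continuous_map hT) continuous_id

/-- A countable family of continuous functions determining probability measures, rescaled so that
the squares of all integrals against probability measures are summable. -/
theorem exists_separating_sequence (X : Type) [TopologicalSpace X] [CompactSpace X]
    [TopologicalSpace.MetrizableSpace X] [MeasurableSpace X] [BorelSpace X] :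
    ∃ g : ℕ → C(X, ℝ), (∀ i x, |g i x| ≤ (1 / 2 : ℝ) ^ i) ∧
      ∀ μ ν : ProbabilityMeasure X,
        (∀ i, ∫ x, g i x ∂(μ : Measure X) = ∫ x, g i x ∂(ν : Measure X)) → μ = ν := by
  let d := TopologicalSpace.denseSeq C(X, ℝ)
  have hc : ∀ i, 0 < (1 / 2 : ℝ) ^ i / (1 + ‖d i‖) := fun i => by positivity
  refine ⟨fun i => ((1 / 2 : ℝ) ^ i / (1 + ‖d i‖)) • d i, fun i x => ?_, fun μ ν h => ?_⟩
  · have h1 : |d i x| ≤ 1 + ‖d i‖ := ((d i).norm_coe_le_norm x).trans (by linarith)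
    have h2 : 0 < 1 + ‖d i‖ := by positivity
    rw [ContinuousMap.smul_apply, smul_eq_mul, abs_mul, abs_of_pos (hc i), div_mul_eq_mul_div,
      div_le_iff₀ h2]
    gcongr
  · have hd : ∀ i, ∫ x, d i x ∂(μ : Measure X) = ∫ x, d i x ∂(ν : Measure X) := by
      intro i
      have := h i
      simp only [ContinuousMap.smul_apply, smul_eq_mul, integral_const_mul] at this
      exact mul_left_cancel₀ (hc i).ne' this
    have hcont : ∀ κ : ProbabilityMeasure X,
        Continuous fun f : C(X, ℝ) => ∫ x, f x ∂(κ : Measure X) := by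
      intro κ
      refine continuous_iff_continuousAt.2 fun f => Metric.continuousAt_iff.2 fun ε hε => ?_
      refine ⟨ε, hε, fun f' hf' => ?_⟩
      have hi : ∀ f : C(X, ℝ), Integrable f (κ : Measure X) := fun f =>
        (BoundedContinuousFunction.mkOfCompact f).integrable _
      rw [dist_eq_norm, ← integral_sub (hi f') (hi f)]
      refine (norm_integral_le_of_norm_le_const (C := dist f' f) (.of_forall fun x => ?_)).trans_lt
        ?_
      · rw [← dist_eq_norm]
        exact ContinuousMap.dist_apply_le_dist x
      · simpa using hf'
    have heq := (TopologicalSpace.denseRange_denseSeq C(X, ℝ)).equalizer (hcont μ) (hcont ν)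
      (funext hd)
    have hμν : (μ : Measure X) = ν := ext_of_forall_integral_eq_of_IsFiniteMeasure fun f =>
      congrFun heq f.toContinuousMap
    exact Subtype.ext hμν

/-- A strictly convex continuous function on a compact convex set attains its maximum only at
extreme points. Among the invariant measures maximizing the integral of `g₀`, one maximizes the
strictly convex `Φ`, the sum of squares of separating integrals. The maximizers of the linear
functional form a face, so this measure is extreme among all invariant measures, hence ergodic. -/
theorem exists_ergodic_integral_ge {T : X → X} (hT : Continuous T) {g₀ : X → ℝ}
    (hg₀ : Continuous g₀) {ν : ProbabilityMeasure X}
    (hν : MeasurePreserving T (ν : Measure X) (ν : Measure X)) :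
    ∃ μ : ProbabilityMeasure X, Ergodic T (μ : Measure X) ∧
      ∫ x, g₀ x ∂(ν : Measure X) ≤ ∫ x, g₀ x ∂(μ : Measure X) := by
  obtain ⟨g, hgb, hgs⟩ := exists_separating_sequence X
  have hcont : ∀ f : C(X, ℝ),
      Continuous fun κ : ProbabilityMeasure X => ∫ x, f x ∂(κ : Measure X) := fun f =>
    ProbabilityMeasure.continuous_integral_continuousMap f
  have hint : ∀ (f : C(X, ℝ)) (κ : Measure X), IsProbabilityMeasure κ → Integrable f κ :=
    fun f κ _ => (BoundedContinuousFunction.mkOfCompact f).integrable _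
  have hbd : ∀ i (κ : ProbabilityMeasure X), (∫ x, g i x ∂(κ : Measure X)) ^ 2 ≤ (1 / 2) ^ i := by
    intro i κ
    have h1 : |∫ x, g i x ∂(κ : Measure X)| ≤ (1 / 2) ^ i := by
      have : ‖∫ x, g i x ∂(κ : Measure X)‖ ≤ (1 / 2) ^ i * (κ : Measure X).real Set.univ :=
        norm_integral_le_of_norm_le_const (.of_forall fun x => hgb i x)
      simpa using this
    have h2 : ((1 : ℝ) / 2) ^ i ≤ 1 := pow_le_one₀ (by norm_num) (by norm_num)
    rw [← sq_abs]
    nlinarith [abs_nonneg (∫ x, g i x ∂(κ : Measure X))]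
  have hgeo : Summable fun i : ℕ => (1 / 2 : ℝ) ^ i := summable_geometric_two
  let Φ : ProbabilityMeasure X → ℝ := fun κ => ∑' i, (∫ x, g i x ∂(κ : Measure X)) ^ 2
  have hΦs : ∀ κ : ProbabilityMeasure X, Summable fun i => (∫ x, g i x ∂(κ : Measure X)) ^ 2 :=
    fun κ => hgeo.of_nonneg_of_le (fun _ => sq_nonneg _) fun i => hbd i κ
  have hΦ : Continuous Φ := continuous_tsum (fun i => (hcont (g i)).pow 2) hgeo fun i κ => by
    rw [Real.norm_of_nonneg (sq_nonneg _)]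
    exact hbd i κ
  let G : ProbabilityMeasure X → ℝ := fun κ => ∫ x, g₀ x ∂(κ : Measure X)
  have hG : Continuous G := hcont ⟨g₀, hg₀⟩
  let K : Set (ProbabilityMeasure X) :=
    {κ | MeasurePreserving T (κ : Measure X) (κ : Measure X)}
  have hK : IsCompact K := (isClosed_setOf_measurePreserving hT).isCompact
  obtain ⟨μ₀, hμ₀, hmax₀⟩ := hK.exists_isMaxOn ⟨ν, hν⟩ hG.continuousOn
  have hK' : IsCompact (K ∩ {κ | G κ = G μ₀}) :=
    hK.inter_right (isClosed_eq hG continuous_const)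
  obtain ⟨μ, ⟨hμK, hμG⟩, hmax⟩ := hK'.exists_isMaxOn ⟨μ₀, hμ₀, rfl⟩ hΦ.continuousOn
  refine ⟨μ, ?_, (hmax₀ hν).trans_eq hμG.symm⟩
  refine Ergodic.of_mem_extremePoints ⟨⟨hμK, inferInstance⟩, ?_⟩
  rintro ν₁ ⟨hi₁, hp₁⟩ ν₂ ⟨hi₂, hp₂⟩ ⟨a, b, ha, hb, hab, hμ⟩
  have ha' : a ≠ ⊤ := ne_top_of_le_ne_top ENNReal.one_ne_top (hab ▸ le_self_add)
  have hb' : b ≠ ⊤ := ne_top_of_le_ne_top ENNReal.one_ne_top (hab ▸ le_add_self)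
  have hα : 0 < a.toReal := ENNReal.toReal_pos ha.ne' ha'
  have hβ : 0 < b.toReal := ENNReal.toReal_pos hb.ne' hb'
  have hαβ : a.toReal + b.toReal = 1 := by
    rw [← ENNReal.toReal_add ha' hb', hab, ENNReal.toReal_one]
  let P₁ : ProbabilityMeasure X := ⟨ν₁, hp₁⟩
  let P₂ : ProbabilityMeasure X := ⟨ν₂, hp₂⟩
  have hcomb : ∀ f : C(X, ℝ), ∫ x, f x ∂(μ : Measure X) =
      a.toReal * ∫ x, f x ∂ν₁ + b.toReal * ∫ x, f x ∂ν₂ := by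
    intro f
    rw [← hμ, integral_add_measure ((hint f ν₁ hp₁).smul_measure ha')
      ((hint f ν₂ hp₂).smul_measure hb'), integral_smul_measure, integral_smul_measure,
      smul_eq_mul, smul_eq_mul]
  have hG₁ : G P₁ ≤ G μ := (hmax₀ (show P₁ ∈ K from hi₁)).trans_eq hμG.symm
  have hG₂ : G P₂ ≤ G μ := (hmax₀ (show P₂ ∈ K from hi₂)).trans_eq hμG.symm
  have hGμ : G μ = a.toReal * G P₁ + b.toReal * G P₂ := hcomb ⟨g₀, hg₀⟩
  have hfix : ∀ t : ℝ, a.toReal * t + b.toReal * t = t := fun t => by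
    rw [← add_mul, hαβ, one_mul]
  have hG₁' : G P₁ = G μ := by
    refine le_antisymm hG₁ ?_
    by_contra! h
    linarith [hfix (G μ), mul_lt_mul_of_pos_left h hα, mul_le_mul_of_nonneg_left hG₂ hβ.le]
  have hG₂' : G P₂ = G μ := by
    refine le_antisymm hG₂ ?_
    by_contra! h
    linarith [hfix (G μ), mul_lt_mul_of_pos_left h hβ, mul_le_mul_of_nonneg_left hG₁ hα.le]
  have hΦ₁ : Φ P₁ ≤ Φ μ := hmax ⟨hi₁, hG₁'.trans hμG⟩
  have hΦ₂ : Φ P₂ ≤ Φ μ := hmax ⟨hi₂, hG₂'.trans hμG⟩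
  let D : ℕ → ℝ := fun i => (∫ x, g i x ∂ν₁ - ∫ x, g i x ∂ν₂) ^ 2
  -- Variance identity for weights with sum one. Summed over `i`, it measures the convexity defect
  -- of `Φ`, which maximality makes nonpositive, so every `D i` vanishes.
  have hterm : ∀ i, a.toReal * b.toReal * D i = a.toReal * (∫ x, g i x ∂ν₁) ^ 2 +
      b.toReal * (∫ x, g i x ∂ν₂) ^ 2 - (∫ x, g i x ∂(μ : Measure X)) ^ 2 := by
    intro i
    rw [hcomb (g i)]
    have : b.toReal = 1 - a.toReal := by linarith
    simp only [D, this]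
    ring
  have hsum : HasSum (fun i => a.toReal * b.toReal * D i)
      (a.toReal * Φ P₁ + b.toReal * Φ P₂ - Φ μ) := by
    simp only [hterm]
    exact (((hΦs P₁).hasSum.mul_left _).add ((hΦs P₂).hasSum.mul_left _)).sub (hΦs μ).hasSum
  have hle : a.toReal * Φ P₁ + b.toReal * Φ P₂ - Φ μ ≤ 0 := by
    linarith [hfix (Φ μ), mul_le_mul_of_nonneg_left hΦ₁ hα.le, mul_le_mul_of_nonneg_left hΦ₂ hβ.le]
  have hD : ∀ i, 0 ≤ a.toReal * b.toReal * D i := fun i =>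
    mul_nonneg (mul_nonneg hα.le hβ.le) (sq_nonneg _)
  have hP : P₁ = P₂ := by
    refine hgs _ _ fun i => ?_
    have h1 : a.toReal * b.toReal * D i ≤ 0 := (le_hasSum hsum i fun j _ => hD j).trans hle
    have h2 : D i = 0 := by
      have := le_antisymm h1 (hD i)
      simpa [hα.ne', hβ.ne'] using this
    exact sub_eq_zero.1 (pow_eq_zero_iff two_ne_zero |>.1 h2)
  have h12 : ν₁ = ν₂ := congrArg Subtype.val hP
  rw [← hμ, ← h12, ← add_smul, hab, one_smul]

end Extreme

theorem classErgodicFixed_subset_classID : classErgodicFixed ⊆ classID := by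
  rintro Y hY ν ⟨x, N, hN, hgen⟩
  have hν := hgen.measurePreserving Y.T.continuous hN
  have hg : Continuous fun y => dist (Y.T y) y := Y.T.continuous.dist continuous_id
  obtain ⟨μ, hμ, hle⟩ := exists_ergodic_integral_ge Y.T.continuous hg hν
  obtain ⟨p, hp, hμp⟩ := hY μ hμ
  rw [hμp, integral_dirac' _ _ hg.measurable.stronglyMeasurable, hp, dist_self] at hle
  have h0 : ∫ y, dist (Y.T y) y ∂(ν : Measure Y.X) = 0 :=
    le_antisymm hle (integral_nonneg fun _ => dist_nonneg)
  have := (integral_eq_zero_iff_of_nonneg (fun _ => dist_nonneg)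
    ((BoundedContinuousFunction.mkOfCompact ⟨_, hg⟩).integrable _)).1 h0
  filter_upwards [this] with y hy
  exact dist_eq_zero.1 hy

/-! ### From the short interval condition to orthogonality. -/

theorem compactSpace_orbitClosure {u : ℕ → ℂ} (hu : ∃ L : ℝ, ∀ n : ℕ, ‖u n‖ ≤ L) :
    CompactSpace (orbitClosure u) := by
  obtain ⟨L, hL⟩ := hu
  have hc : IsCompact (Set.univ.pi fun _ : ℤ => Metric.closedBall (0 : ℂ) L) :=
    isCompact_univ_pi fun _ => isCompact_closedBall _ _
  rw [← isCompact_iff_compactSpace]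
  refine hc.of_isClosed_subset isClosed_closure (closure_minimal ?_ hc.isClosed)
  rintro _ ⟨m, rfl⟩ k -
  simpa [extendToInt] using hL (k + m).natAbs

theorem norm_sum_sub_sum_shift_le {b : ℕ → ℂ} {B : ℝ} (hb : ∀ n, ‖b n‖ ≤ B) (N h : ℕ) :
    ‖∑ n ∈ Finset.Icc 1 N, b n - ∑ n ∈ Finset.Icc 1 N, b (n + h)‖ ≤ 2 * h * B := by
  induction h with
  | zero => simp
  | succ h ih =>
    have htel : ∑ n ∈ Finset.Icc 1 N, b (n + h) - ∑ n ∈ Finset.Icc 1 N, b (n + (h + 1)) =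
        b (1 + h) - b (N + 1 + h) := by
      have := Finset.sum_Ico_sub (fun n => b (n + h)) (show 1 ≤ N + 1 by lia)
      rw [← neg_sub (b (N + 1 + h)), ← this, ← Finset.sum_sub_distrib, ← Finset.sum_neg_distrib]
      refine Finset.sum_congr (by ext; simp) fun n _ => ?_
      rw [neg_sub, show n + 1 + h = n + (h + 1) by ring]
    calc _ = ‖(∑ n ∈ Finset.Icc 1 N, b n - ∑ n ∈ Finset.Icc 1 N, b (n + h)) +
          (b (1 + h) - b (N + 1 + h))‖ := by rw [← htel]; congr 1; ring
      _ ≤ 2 * h * B + (B + B) :=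
        (norm_add_le _ _).trans (add_le_add ih ((norm_sub_le _ _).trans (add_le_add (hb _) (hb _))))
      _ = _ := by push_cast; ring

/-- Shifting the summation index by `h` costs boundary terms, and replacing `a (n + h)` by `a n`
costs the variation of `a`; averaging over `h` puts the short mean of `u` in place of `u n`. The
factor `1 / H` is dropped from the error, which is harmless when `H` is fixed and `N` grows. -/
theorem norm_sum_mul_le {a u : ℕ → ℂ} {C L : ℝ} (ha : ∀ n, ‖a n‖ ≤ C) (hu : ∀ n, ‖u n‖ ≤ L)
    {H : ℕ} (hH : 1 ≤ H) (N : ℕ) :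
    ‖∑ n ∈ Finset.Icc 1 N, a n * u n‖ ≤
      C * ∑ n ∈ Finset.Icc 1 N, ‖(1 / (H : ℂ)) * ∑ h ∈ Finset.Icc 1 H, u (n + h)‖ +
      ∑ h ∈ Finset.Icc 1 H, (2 * h * (C * L) +
        L * ∑ n ∈ Finset.Icc 1 N, ‖a (n + h) - a n‖) := by
  have hC : 0 ≤ C := (norm_nonneg _).trans (ha 0)
  have hL : 0 ≤ L := (norm_nonneg _).trans (hu 0)
  have hH0 : (H : ℂ) ≠ 0 := by exact_mod_cast (show H ≠ 0 by lia)
  set S := ∑ n ∈ Finset.Icc 1 N, a n * u n with hS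
  have hav : ∑ n ∈ Finset.Icc 1 N, a n * ((1 / (H : ℂ)) * ∑ h ∈ Finset.Icc 1 H, u (n + h)) =
      (1 / (H : ℂ)) * ∑ h ∈ Finset.Icc 1 H, ∑ n ∈ Finset.Icc 1 N, a n * u (n + h) := by
    rw [Finset.sum_comm, Finset.mul_sum]
    refine Finset.sum_congr rfl fun n _ => ?_
    rw [← Finset.mul_sum]
    ring
  have hSH : S = (1 / (H : ℂ)) * ∑ h ∈ Finset.Icc 1 H, S := by
    rw [Finset.sum_const, Nat.card_Icc, nsmul_eq_mul, Nat.add_sub_cancel]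
    field_simp
  have hone : ∀ h, ‖S - ∑ n ∈ Finset.Icc 1 N, a n * u (n + h)‖ ≤
      2 * h * (C * L) + L * ∑ n ∈ Finset.Icc 1 N, ‖a (n + h) - a n‖ := by
    intro h
    have h1 : ‖S - ∑ n ∈ Finset.Icc 1 N, a (n + h) * u (n + h)‖ ≤ 2 * h * (C * L) :=
      norm_sum_sub_sum_shift_le (b := fun n => a n * u n) (fun n => by
        rw [norm_mul]; exact mul_le_mul (ha n) (hu n) (norm_nonneg _) hC) N h
    have h2 : ‖∑ n ∈ Finset.Icc 1 N, a (n + h) * u (n + h) -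
        ∑ n ∈ Finset.Icc 1 N, a n * u (n + h)‖ ≤
        L * ∑ n ∈ Finset.Icc 1 N, ‖a (n + h) - a n‖ := by
      rw [← Finset.sum_sub_distrib, Finset.mul_sum]
      refine norm_sum_le_of_le _ fun n _ => ?_
      rw [← sub_mul, norm_mul, mul_comm]
      exact mul_le_mul_of_nonneg_right (hu _) (norm_nonneg _)
    exact (norm_sub_le_norm_sub_add_norm_sub _ _ _).trans (add_le_add h1 h2)
  have hdiff : ‖S - ∑ n ∈ Finset.Icc 1 N,
      a n * ((1 / (H : ℂ)) * ∑ h ∈ Finset.Icc 1 H, u (n + h))‖ ≤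
      ∑ h ∈ Finset.Icc 1 H, (2 * h * (C * L) +
        L * ∑ n ∈ Finset.Icc 1 N, ‖a (n + h) - a n‖) := by
    rw [hav]
    nth_rewrite 1 [hSH]
    rw [← mul_sub, ← Finset.sum_sub_distrib, norm_mul]
    have h1 : ‖(1 / (H : ℂ))‖ ≤ 1 := by
      rw [norm_div, norm_one, Complex.norm_natCast]
      exact div_le_one_of_le₀ (by exact_mod_cast hH) (by positivity)
    calc _ ≤ 1 * ‖∑ h ∈ Finset.Icc 1 H, (S - ∑ n ∈ Finset.Icc 1 N, a n * u (n + h))‖ := by gcongr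
      _ ≤ _ := by rw [one_mul]; exact norm_sum_le_of_le _ fun h _ => hone h
  have hmain : ‖∑ n ∈ Finset.Icc 1 N,
      a n * ((1 / (H : ℂ)) * ∑ h ∈ Finset.Icc 1 H, u (n + h))‖ ≤
      C * ∑ n ∈ Finset.Icc 1 N, ‖(1 / (H : ℂ)) * ∑ h ∈ Finset.Icc 1 H, u (n + h)‖ := by
    rw [Finset.mul_sum]
    refine norm_sum_le_of_le _ fun n _ => ?_
    rw [norm_mul]
    exact mul_le_mul_of_nonneg_right (ha n) (norm_nonneg _)
  calc ‖S‖ ≤ _ := norm_le_norm_add_norm_sub' S _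
    _ ≤ _ := add_le_add hmain hdiff

theorem average_norm_le_add_shortIntervalMean (u : ℕ → ℂ) (H N : ℕ) {η : ℝ} (hη : 0 < η) :
    (1 / (N : ℝ)) * ∑ n ∈ Finset.Icc 1 N, ‖(1 / (H : ℂ)) * ∑ h ∈ Finset.Icc 1 H, u (n + h)‖ ≤
      η + shortIntervalMean u H N / η := by
  -- This pointwise bound does the work of Cauchy–Schwarz.
  have hpt : ∀ t : ℝ, t ≤ η + t ^ 2 / η := by
    intro t
    rw [← sub_nonneg, show η + t ^ 2 / η - t = ((t - η / 2) ^ 2 + 3 / 4 * η ^ 2) / η by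
      field_simp; ring]
    positivity
  rcases Nat.eq_zero_or_pos N with rfl | hN
  · simpa [shortIntervalMean] using hη.le
  have hN' : (0 : ℝ) < N := by exact_mod_cast hN
  calc _ ≤ (1 / (N : ℝ)) * ∑ n ∈ Finset.Icc 1 N,
        (η + ‖(1 / (H : ℂ)) * ∑ h ∈ Finset.Icc 1 H, u (n + h)‖ ^ 2 / η) := by
        gcongr
        exact hpt _
    _ = _ := by
        rw [Finset.sum_add_distrib, Finset.sum_const, Nat.card_Icc, nsmul_eq_mul,
          Nat.add_sub_cancel, ← Finset.sum_div, shortIntervalMean]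
        field_simp

theorem tendsto_average_mul_zero {a u : ℕ → ℂ} {C L : ℝ} (ha : ∀ n, ‖a n‖ ≤ C)
    (hu : ∀ n, ‖u n‖ ≤ L) {N : ℕ → ℕ} (hN : Tendsto N atTop atTop)
    (hslow : ∀ h : ℕ, Tendsto (fun k => (1 / (N k : ℝ)) *
      ∑ n ∈ Finset.Icc 1 (N k), ‖a (n + h) - a n‖) atTop (𝓝 0))
    (hS : ∀ ε : ℝ, 0 < ε → ∃ H : ℕ, 1 ≤ H ∧
      ∃ l : ℝ, Tendsto (fun k => shortIntervalMean u H (N k)) atTop (𝓝 l) ∧ l ≤ ε) :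
    Tendsto (fun k => (1 / (N k : ℂ)) * ∑ n ∈ Finset.Icc 1 (N k), a n * u n) atTop (𝓝 0) := by
  have hC : 0 ≤ C := (norm_nonneg _).trans (ha 0)
  rw [NormedAddGroup.tendsto_nhds_zero]
  intro ρ hρ
  -- With mean square below `2 * η ^ 2`, the mean of the short averages is at most `η + 2 * η`; the
  -- choice of `η` makes `C` times this at most `ρ / 2`.
  set η := ρ / (6 * (C + 1)) with hηdef
  have hη : 0 < η := by positivity
  have hCη : C * (3 * η) ≤ ρ / 2 := by
    rw [hηdef, show C * (3 * (ρ / (6 * (C + 1)))) = ρ / 2 * (C / (C + 1)) by field_simp; ring]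
    exact mul_le_of_le_one_right (by positivity) (div_le_one_of_le₀ (by linarith) (by positivity))
  obtain ⟨H, hH, l, hl, hle⟩ := hS (η ^ 2) (by positivity)
  have hNt : Tendsto (fun k => 1 / ((N k : ℕ) : ℝ)) atTop (𝓝 0) :=
    tendsto_one_div_atTop_nhds_zero_nat.comp hN
  have herr : Tendsto (fun k => ∑ h ∈ Finset.Icc 1 H, (2 * h * (C * L) * (1 / (N k : ℝ)) +
      L * ((1 / (N k : ℝ)) * ∑ n ∈ Finset.Icc 1 (N k), ‖a (n + h) - a n‖))) atTop (𝓝 0) := by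
    have : Tendsto (fun k => ∑ h ∈ Finset.Icc 1 H, (2 * h * (C * L) * (1 / (N k : ℝ)) +
        L * ((1 / (N k : ℝ)) * ∑ n ∈ Finset.Icc 1 (N k), ‖a (n + h) - a n‖))) atTop
        (𝓝 (∑ h ∈ Finset.Icc 1 H, (2 * h * (C * L) * 0 + L * 0))) :=
      tendsto_finsetSum _ fun h _ => (hNt.const_mul _).add ((hslow h).const_mul _)
    simpa using this
  have hS2 : ∀ᶠ k in atTop, shortIntervalMean u H (N k) < 2 * η ^ 2 :=
    hl.eventually_lt_const (by nlinarith [sq_pos_of_pos hη])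
  filter_upwards [hS2, herr.eventually_lt_const (half_pos hρ)] with k hk1 hk2
  have h1 := norm_sum_mul_le ha hu hH (N k)
  have h2 := average_norm_le_add_shortIntervalMean u H (N k) hη
  have h3 : shortIntervalMean u H (N k) / η ≤ 2 * η := by
    rw [div_le_iff₀ hη]
    nlinarith
  rw [norm_mul, norm_div, norm_one, Complex.norm_natCast]
  calc _ ≤ (1 / (N k : ℝ)) * (C * ∑ n ∈ Finset.Icc 1 (N k),
          ‖(1 / (H : ℂ)) * ∑ h ∈ Finset.Icc 1 H, u (n + h)‖ +
        ∑ h ∈ Finset.Icc 1 H, (2 * h * (C * L) +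
          L * ∑ n ∈ Finset.Icc 1 (N k), ‖a (n + h) - a n‖)) := by gcongr
    _ = C * ((1 / (N k : ℝ)) * ∑ n ∈ Finset.Icc 1 (N k),
          ‖(1 / (H : ℂ)) * ∑ h ∈ Finset.Icc 1 H, u (n + h)‖) +
        ∑ h ∈ Finset.Icc 1 H, (2 * h * (C * L) * (1 / (N k : ℝ)) +
          L * ((1 / (N k : ℝ)) * ∑ n ∈ Finset.Icc 1 (N k), ‖a (n + h) - a n‖)) := by
        rw [mul_add, Finset.mul_sum (Finset.Icc 1 H)]
        congr 1
        · ring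
        · exact Finset.sum_congr rfl fun h _ => by ring
    _ < ρ / 2 + ρ / 2 := by
        refine add_lt_add_of_le_of_lt (le_trans ?_ hCη) hk2
        exact mul_le_mul_of_nonneg_left (by linarith) hC
    _ = ρ := by ring

/-- It suffices to find good subsequences. Two compactness extractions make `x` generic for some `ν`
and `u` generic for a Furstenberg system along the same sequence. Since `T` is the identity
`ν`-almost everywhere, the mean variation of `f (T^n x)` under each fixed shift tends to zero. -/
theorem orthogonalToClass_classID_of_shortIntervalCondition {u : ℕ → ℂ}
    (hu : ∃ L : ℝ, ∀ n : ℕ, ‖u n‖ ≤ L) (hS : ShortIntervalCondition u) :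
    OrthogonalToClass u classID := by
  have := compactSpace_orbitClosure hu
  obtain ⟨L, hL⟩ := hu
  intro Y hY f x
  refine tendsto_of_subseq_tendsto fun ns hns => ?_
  obtain ⟨φ₁, hφ₁, hm₁⟩ := strictMono_subseq_of_tendsto_atTop hns
  obtain ⟨φ₂, hφ₂, ν, hν⟩ := exists_isGenericAlong_subseq Y.T x hm₁
  have hm₂ := hm₁.comp hφ₂
  obtain ⟨φ₃, hφ₃, κ, hκ⟩ := exists_isGenericAlong_subseq (subshiftMap u) (subshiftPoint u) hm₂
  have hm₃ := hm₂.comp hφ₃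
  have hν₃ := hν.comp hφ₃
  have hid := hY ν ⟨x, _, hm₂, hν⟩
  refine ⟨φ₁ ∘ φ₂ ∘ φ₃, ?_⟩
  refine tendsto_average_mul_zero (a := fun n => f (Y.T^[n] x)) (C := ‖f‖)
    (fun n => f.norm_coe_le_norm _) hL hm₃.tendsto_atTop (fun h => ?_) (fun ε hε => ?_)
  · have hg : Continuous fun y => ‖f (Y.T^[h] y) - f y‖ :=
      ((f.continuous.comp (Y.T.continuous.iterate h)).sub f.continuous).norm
    have h0 : ∫ y, ‖f (Y.T^[h] y) - f y‖ ∂(ν : Measure Y.X) = 0 := by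
      refine integral_eq_zero_of_ae ?_
      filter_upwards [hid] with y hy
      simp [Function.iterate_fixed hy h]
    have := hν₃.tendsto_average hg
    rw [h0] at this
    simpa only [← Function.iterate_add_apply, add_comm h, Function.comp_apply] using this
  · obtain ⟨H₀, hH₀, h⟩ := hS ε hε _ ⟨hm₃, κ, hκ⟩
    exact ⟨H₀, hH₀, h H₀ le_rfl⟩

/-! ### Subshifts of slowly varying sequences. -/

theorem subshiftMap_iterate_apply (v : ℕ → ℂ) (k : ℕ) (z : orbitClosure v) (j : ℤ) :
    ((subshiftMap v)^[k] z).1 j = z.1 (j + k) := by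
  induction k generalizing j with
  | zero => simp
  | succ k ih =>
    rw [Function.iterate_succ_apply']
    change ((subshiftMap v)^[k] z).1 (j + 1) = _
    rw [ih]
    exact congrArg z.1 (by push_cast; ring)

theorem continuous_orbitClosure_apply (v : ℕ → ℂ) (j : ℤ) :
    Continuous fun z : orbitClosure v => z.1 j :=
  (continuous_apply j).comp continuous_subtype_val

/-- The short interval mean is an orbit average of a continuous function on the subshift, so its
limit always exists and only the bound by `ε` has content. -/
theorem DefinesFurstenbergSystem.exists_tendsto_shortIntervalMean {u : ℕ → ℂ}
    (hu : ∃ L : ℝ, ∀ n : ℕ, ‖u n‖ ≤ L) {N : ℕ → ℕ} (h : DefinesFurstenbergSystem u N) (H : ℕ) :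
    ∃ l : ℝ, Tendsto (fun k => shortIntervalMean u H (N k)) atTop (𝓝 l) := by
  have := compactSpace_orbitClosure hu
  obtain ⟨-, κ, hκ⟩ := h
  have hf : Continuous fun z : orbitClosure u =>
      ‖(1 / (H : ℂ)) * ∑ h ∈ Finset.Icc 1 H, z.1 (h : ℤ)‖ ^ 2 := by
    have hc := fun h : ℕ => continuous_orbitClosure_apply u (h : ℤ)
    have hs : Continuous fun z : orbitClosure u => ∑ h ∈ Finset.Icc 1 H, z.1 (h : ℤ) :=
      continuous_finsetSum _ fun h _ => hc h
    exact (continuous_const.mul hs).norm.pow 2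
  have hz : ∀ n i : ℕ, ((subshiftMap u)^[n] (subshiftPoint u)).1 (i : ℤ) = u (n + i) := by
    intro n i
    rw [subshiftMap_iterate_apply]
    change u (((i : ℤ) + n).natAbs) = _
    rw [show ((i : ℤ) + n).natAbs = n + i by lia]
  have hlim := hκ.tendsto_average hf
  simp only [hz] at hlim
  exact ⟨_, hlim⟩

/-- If the increments of `v` tend to zero, so do those of every point of its subshift. -/
theorem tendsto_increment_of_mem_orbitClosure {v : ℕ → ℂ}
    (hv : Tendsto (fun n => ‖v (n + 1) - v n‖) atTop (𝓝 0)) {z : ℤ → ℂ}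
    (hz : z ∈ orbitClosure v) (j : ℤ) :
    Tendsto (fun k : ℕ => ‖z (j + k + 1) - z (j + k)‖) atTop (𝓝 0) := by
  rw [Metric.tendsto_atTop]
  intro δ' hδ'
  obtain ⟨δ, hδ, hδδ'⟩ := exists_between hδ'
  obtain ⟨M, hM⟩ := eventually_atTop.1 (hv.eventually_le_const hδ)
  -- By the symmetric extension, increments of `v` outside `E` are at most `δ` on both tails, so a
  -- translate has at most `E.card` larger ones. Phrased through finite sets `F`, this bound is a
  -- closed condition and passes to the orbit closure.
  let E : Finset ℤ := Finset.Icc (-M - 1) M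
  let W : Set (ℤ → ℂ) :=
    {z | ∀ F : Finset ℤ, E.card < F.card → ∃ n ∈ F, ‖z (n + 1) - z n‖ ≤ δ}
  have hW : IsClosed W := by
    have : W = ⋂ F : Finset ℤ, ⋂ _ : E.card < F.card, ⋃ n ∈ (F : Set ℤ),
        {z | ‖z (n + 1) - z n‖ ≤ δ} := by
      ext z
      simp [W]
    rw [this]
    refine isClosed_iInter fun F => isClosed_iInter fun _ =>
      F.finite_toSet.isClosed_biUnion fun n _ => ?_
    exact isClosed_le (by fun_prop) continuous_const
  have hmem : orbitClosure v ⊆ W := by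
    refine closure_minimal ?_ hW
    rintro _ ⟨m, rfl⟩ F hF
    obtain ⟨n, hn, hnE⟩ : ∃ n ∈ F.image (· + m), n ∉ E := by
      by_contra! h
      refine absurd (Finset.card_le_card h) (not_le.2 ?_)
      rwa [Finset.card_image_of_injective _ (add_left_injective m)]
    obtain ⟨i, hi, rfl⟩ := Finset.mem_image.1 hn
    refine ⟨i, hi, ?_⟩
    simp only [extendToInt]
    have hiE : ¬ (-(M : ℤ) - 1 ≤ i + m ∧ i + m ≤ M) := by simpa [E] using hnE
    rcases lt_or_ge (M : ℤ) (i + m) with h | h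
    · rw [show (i + 1 + m).natAbs = (i + m).natAbs + 1 by lia]
      exact hM _ (by lia)
    · rw [show (i + m).natAbs = (i + 1 + m).natAbs + 1 by lia, norm_sub_rev]
      exact hM _ (by lia)
  have hev : ∀ᶠ k : ℕ in atTop, ‖z (j + k + 1) - z (j + k)‖ ≤ δ := by
    by_contra hcon
    have hinf := Nat.frequently_atTop_iff_infinite.1 (not_eventually.1 hcon)
    obtain ⟨F, hFs, hFc⟩ := hinf.exists_subset_card_eq (E.card + 1)
    obtain ⟨n, hn, hle⟩ := hmem hz (F.image fun k : ℕ => j + k) (by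
      rw [Finset.card_image_of_injective _ fun a b hab => by simpa using hab]
      lia)
    obtain ⟨k, hk, rfl⟩ := Finset.mem_image.1 hn
    exact hFs hk hle
  obtain ⟨K, hK⟩ := eventually_atTop.1 hev
  refine ⟨K, fun k hk => ?_⟩
  rw [dist_zero_right, norm_norm]
  exact (hK k hk).trans_lt hδδ'

/-- Increments vanish along every forward orbit, while their integral is invariant; dominated
convergence makes them zero almost everywhere. So the shift is almost everywhere the identity, and
ergodicity makes the invariant map `id` almost everywhere constant. -/
theorem exists_eq_dirac_of_ergodic_subshiftMap {v : ℕ → ℂ}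
    (hb : ∃ L : ℝ, ∀ n : ℕ, ‖v n‖ ≤ L)
    (hv : Tendsto (fun n => ‖v (n + 1) - v n‖) atTop (𝓝 0))
    (ν : Measure (orbitClosure v)) [IsProbabilityMeasure ν] (hν : Ergodic (subshiftMap v) ν) :
    ∃ p, subshiftMap v p = p ∧ ν = Measure.dirac p := by
  have := compactSpace_orbitClosure hb
  have hzero : ∀ j : ℤ, ∀ᵐ z ∂ν, z.1 (j + 1) = z.1 j := by
    intro j
    let g : orbitClosure v → ℝ := fun z => ‖z.1 (j + 1) - z.1 j‖
    have hg : Continuous g :=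
      ((continuous_orbitClosure_apply v _).sub (continuous_orbitClosure_apply v _)).norm
    let G := BoundedContinuousFunction.mkOfCompact ⟨g, hg⟩
    have hT : ∀ k : ℕ, ∫ z, g ((subshiftMap v)^[k] z) ∂ν = ∫ z, g z ∂ν := by
      intro k
      have hmp := hν.toMeasurePreserving.iterate k
      conv_rhs => rw [← hmp.map_eq]
      rw [integral_map hmp.measurable.aemeasurable hg.aestronglyMeasurable]
    have hlim : Tendsto (fun k : ℕ => ∫ z, g ((subshiftMap v)^[k] z) ∂ν) atTop
        (𝓝 (∫ _, (0 : ℝ) ∂ν)) := by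
      refine tendsto_integral_of_dominated_convergence (fun _ => ‖G‖)
        (fun k => (hg.comp ((subshiftMap v).continuous.iterate k)).aestronglyMeasurable)
        (integrable_const _) (fun k => .of_forall fun z => G.norm_coe_le_norm _)
        (.of_forall fun z => ?_)
      refine (tendsto_increment_of_mem_orbitClosure hv z.2 j).congr fun k => ?_
      simp only [g, subshiftMap_iterate_apply]
      rw [show j + 1 + (k : ℤ) = j + k + 1 by ring]
    simp only [hT, integral_zero] at hlim
    have h0 : ∫ z, g z ∂ν = 0 := tendsto_nhds_unique tendsto_const_nhds hlim
    have := (integral_eq_zero_iff_of_nonneg (fun z => norm_nonneg _) (G.integrable ν)).1 h0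
    filter_upwards [this] with z hz
    exact sub_eq_zero.1 (norm_eq_zero.1 hz)
  have hfix : ∀ᵐ z ∂ν, subshiftMap v z = z := by
    filter_upwards [ae_all_iff.2 hzero] with z hz
    exact Subtype.ext (funext hz)
  have : Nonempty (orbitClosure v) := ⟨subshiftPoint v⟩
  obtain ⟨c, hc⟩ := hν.ae_eq_const_of_ae_eq_comp₀ (g := id) measurable_id.nullMeasurable hfix
  have hdirac : ν = Measure.dirac c := by
    conv_lhs => rw [← Measure.map_id (μ := ν), Measure.map_congr hc]
    exact (Measure.map_const ν c).trans (by rw [measure_univ, one_smul])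
  refine ⟨c, ?_, hdirac⟩
  rw [hdirac, ae_dirac_eq] at hfix
  exact hfix

/-- The subshift of a bounded sequence as a topological system. -/
noncomputable def subshiftSystem (v : ℕ → ℂ) (hb : ∃ L : ℝ, ∀ n : ℕ, ‖v n‖ ≤ L) : TopSystem where
  X := orbitClosure v
  metric := TopologicalSpace.metrizableSpaceMetric (orbitClosure v)
  compact := compactSpace_orbitClosure hb
  meas := inferInstance
  borel := (inferInstance : BorelSpace (orbitClosure v))
  T := subshiftMap v

theorem subshiftSystem_mem_classErgodicFixed {v : ℕ → ℂ} (hb : ∃ L : ℝ, ∀ n : ℕ, ‖v n‖ ≤ L)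
    (hv : Tendsto (fun n => ‖v (n + 1) - v n‖) atTop (𝓝 0)) :
    subshiftSystem v hb ∈ classErgodicFixed := fun ν hν =>
  @exists_eq_dirac_of_ergodic_subshiftMap v hb hv ν.1 ν.2 hν

/-- The sequence `v` is read off its own subshift by the zeroth coordinate along the orbit of `v`.
-/
theorem OrthogonalToClass.tendsto_of_increment {u : ℕ → ℂ}
    (h : OrthogonalToClass u classErgodicFixed) {v : ℕ → ℂ} (hb : ∃ L : ℝ, ∀ n : ℕ, ‖v n‖ ≤ L)
    (hv : Tendsto (fun n => ‖v (n + 1) - v n‖) atTop (𝓝 0)) :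
    Tendsto (fun N : ℕ => (1 / (N : ℂ)) * ∑ n ∈ Finset.Icc 1 N, v n * u n) atTop (𝓝 0) := by
  have := h _ (subshiftSystem_mem_classErgodicFixed hb hv)
    ⟨fun z : orbitClosure v => z.1 0, continuous_orbitClosure_apply v 0⟩ (subshiftPoint v)
  refine this.congr fun N => ?_
  congr 1
  refine Finset.sum_congr rfl fun n _ => ?_
  congr 1
  refine (subshiftMap_iterate_apply v n (subshiftPoint v) 0).trans ?_
  simp [subshiftPoint, extendToInt]

/-! ### A slowly growing window length that detects failure of the condition. -/

/-- The average of `u` over `(n, n + H]`. -/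
noncomputable def windowAverage (u : ℕ → ℂ) (H n : ℕ) : ℂ :=
  (1 / (H : ℂ)) * ∑ h ∈ Finset.Icc 1 H, u (n + h)

theorem norm_windowAverage_le {u : ℕ → ℂ} {L : ℝ} (hu : ∀ n, ‖u n‖ ≤ L) (H n : ℕ) :
    ‖windowAverage u H n‖ ≤ L := by
  have hL : 0 ≤ L := (norm_nonneg _).trans (hu 0)
  rcases Nat.eq_zero_or_pos H with rfl | hH
  · simpa [windowAverage] using hL
  have hH' : (0 : ℝ) < H := by exact_mod_cast hH
  rw [windowAverage, norm_mul, norm_div, norm_one, Complex.norm_natCast, one_div,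
    inv_mul_le_iff₀ hH']
  refine (norm_sum_le_of_le _ fun h _ => hu _).trans ?_
  simp

/-- The length is constant, equal to `Hs j`, on blocks `(M j, M (j + 1)]`. Each block end is a time
where the mean for `Hs j` exceeds `ε`, taken so late that dropping the earlier blocks loses at most
half of it and that `Hs j` is at most `δ` times it. -/
theorem exists_window_scale {u : ℕ → ℂ} {L : ℝ} (hu : ∀ n, ‖u n‖ ≤ L) {ε δ : ℝ} (hε : 0 < ε)
    (hδ : 0 < δ)
    (h : ∀ H₀ : ℕ, ∃ H > H₀, ∀ M : ℕ, ∃ N ≥ M, ε < shortIntervalMean u H N) :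
    ∃ η : ℕ → ℕ, Monotone η ∧ (∀ n, 1 ≤ η n) ∧ Tendsto η atTop atTop ∧
      ∃ᶠ N : ℕ in atTop, (η N : ℝ) ≤ δ * N ∧
        ε / 2 * N ≤ ∑ n ∈ Finset.Icc 1 N, ‖windowAverage u (η n) n‖ ^ 2 := by
  obtain ⟨Hs, hHs, hHN⟩ := Nat.exists_strictMono_subsequence fun H₀ =>
    let ⟨H, hH, hH'⟩ := h H₀
    (⟨H, hH, Nat.one_le_of_lt hH, hH'⟩ : ∃ H > H₀, 1 ≤ H ∧ ∀ M : ℕ, ∃ N ≥ M,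
      ε < shortIntervalMean u H N)
  have hstep : ∀ j m : ℕ, ∃ N, m < N ∧ L ^ 2 * m ≤ ε / 2 * N ∧ (Hs j : ℝ) ≤ δ * N ∧
      ε * N ≤ ∑ n ∈ Finset.Icc 1 N, ‖windowAverage u (Hs j) n‖ ^ 2 := by
    intro j m
    have h1 : Tendsto (fun N : ℕ => ε / 2 * (N : ℝ)) atTop atTop :=
      tendsto_natCast_atTop_atTop.const_mul_atTop (half_pos hε)
    have h2 : Tendsto (fun N : ℕ => δ * (N : ℝ)) atTop atTop :=
      tendsto_natCast_atTop_atTop.const_mul_atTop hδ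
    obtain ⟨M, hM⟩ := eventually_atTop.1 ((h1.eventually_ge_atTop (L ^ 2 * m)).and
      ((h2.eventually_ge_atTop (Hs j)).and (eventually_gt_atTop m)))
    obtain ⟨N, hN, hlt⟩ := (hHN j).2 M
    obtain ⟨h3, h4, h5⟩ := hM N hN
    refine ⟨N, h5, h3, h4, ?_⟩
    have hN0 : (0 : ℝ) < N := by exact_mod_cast (Nat.zero_le m).trans_lt h5
    rw [shortIntervalMean, one_div, ← div_eq_inv_mul, lt_div_iff₀ hN0] at hlt
    exact hlt.le
  choose F hF1 hF2 hF3 hF4 using hstep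
  obtain ⟨M, hMs⟩ : ∃ M : ℕ → ℕ, ∀ j, M (j + 1) = F j (M j) :=
    ⟨fun j => Nat.rec 0 F j, fun _ => rfl⟩
  have hM : StrictMono M := strictMono_nat_of_lt_succ fun j => (hF1 j (M j)).trans_eq (hMs j).symm
  have hex : ∀ n, ∃ j, n ≤ M (j + 1) := fun n => ⟨n, (Nat.le_succ n).trans (hM.le_apply)⟩
  let idx : ℕ → ℕ := fun n => Nat.find (hex n)
  have hidx : Monotone idx := fun a b hab => Nat.find_mono fun j hj => hab.trans hj
  have hidx_eq : ∀ j n, M j < n → n ≤ M (j + 1) → idx n = j := by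
    intro j n h1 h2
    refine (Nat.find_eq_iff _).2 ⟨h2, fun i hi hle => ?_⟩
    exact absurd (hle.trans (hM.monotone (show i + 1 ≤ j by lia))) (by lia)
  have hidx_top : Tendsto idx atTop atTop := tendsto_atTop_atTop_of_monotone hidx fun b =>
    ⟨M (b + 1), (hidx_eq b _ (hM (Nat.lt_succ_self b)) le_rfl).ge⟩
  refine ⟨Hs ∘ idx, hHs.monotone.comp hidx, fun n => (hHN (idx n)).1,
    hHs.tendsto_atTop.comp hidx_top, ?_⟩
  · refine frequently_atTop.2 fun b => ⟨M (b + 1), (Nat.le_succ b).trans hM.le_apply, ?_⟩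
    have hi : idx (M (b + 1)) = b := hidx_eq b _ (hM (Nat.lt_succ_self b)) le_rfl
    have hle : M b ≤ M (b + 1) := (hM (Nat.lt_succ_self b)).le
    refine ⟨by rw [Function.comp_apply, hi, hMs]; exact hF3 b (M b), ?_⟩
    have hsplit : ∀ g : ℕ → ℝ, ∑ n ∈ Finset.Icc 1 (M (b + 1)), g n =
        ∑ n ∈ Finset.Icc 1 (M b), g n + ∑ n ∈ Finset.Ioc (M b) (M (b + 1)), g n := by
      intro g
      exact (Finset.sum_Ioc_consecutive g (Nat.zero_le _) hle).symm
    have h1 := hF4 b (M b)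
    rw [← hMs, hsplit] at h1
    have h2 : ∑ n ∈ Finset.Icc 1 (M b), ‖windowAverage u (Hs b) n‖ ^ 2 ≤ L ^ 2 * M b := by
      refine (Finset.sum_le_card_nsmul _ _ (L ^ 2) fun n _ =>
        pow_le_pow_left₀ (norm_nonneg _) (norm_windowAverage_le hu _ _) 2).trans_eq ?_
      rw [Nat.card_Icc, nsmul_eq_mul, Nat.add_sub_cancel, mul_comm]
    have h3 : ∑ n ∈ Finset.Ioc (M b) (M (b + 1)), ‖windowAverage u ((Hs ∘ idx) n) n‖ ^ 2 =
        ∑ n ∈ Finset.Ioc (M b) (M (b + 1)), ‖windowAverage u (Hs b) n‖ ^ 2 := by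
      refine Finset.sum_congr rfl fun n hn => ?_
      rw [Finset.mem_Ioc] at hn
      rw [Function.comp_apply, hidx_eq b n hn.1 hn.2]
    have h4 : 0 ≤ ∑ n ∈ Finset.Icc 1 (M b), ‖windowAverage u ((Hs ∘ idx) n) n‖ ^ 2 :=
      Finset.sum_nonneg fun _ _ => sq_nonneg _
    have h5 := hF2 b (M b)
    rw [← hMs] at h5
    rw [hsplit, h3]
    linarith

/-! ### The superposition of windows and its correlation with the sequence. -/

section Smoothing

variable {η : ℕ → ℕ}

/-- The starting points `n < m` of the windows `(n, n + η n]` containing `m`. -/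
def activeWindows (η : ℕ → ℕ) (m : ℕ) : Finset ℕ := {n ∈ Finset.range m | m ≤ n + η n}

theorem mem_activeWindows {m n : ℕ} : n ∈ activeWindows η m ↔ n < m ∧ m ≤ n + η n := by
  simp [activeWindows]

/-- The superposition `∑ (1 / η n) conj (A n) 1_{(n, n + η n]}` of the window averages `A n`. -/
noncomputable def windowSuperposition (u : ℕ → ℂ) (η : ℕ → ℕ) (m : ℕ) : ℂ :=
  ∑ n ∈ activeWindows η m, (1 / (η n : ℂ)) * starRingEnd ℂ (windowAverage u (η n) n)

theorem card_activeWindows_le {m n : ℕ} (hn : n ∈ activeWindows η m)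
    (hmin : ∀ i ∈ activeWindows η m, n ≤ i) : (activeWindows η m).card ≤ η n := by
  have hsub : activeWindows η m ⊆ Finset.Ico n m := fun i hi =>
    Finset.mem_Ico.2 ⟨hmin i hi, (mem_activeWindows.1 hi).1⟩
  have h1 := Finset.card_le_card hsub
  rw [Nat.card_Ico] at h1
  have h2 := (mem_activeWindows.1 hn).2
  lia

theorem card_activeWindows_le_apply (hη : Monotone η) (m : ℕ) :
    (activeWindows η m).card ≤ η m := by
  rcases (activeWindows η m).eq_empty_or_nonempty with h | h
  · simp [h]
  · exact (card_activeWindows_le (Finset.min'_mem _ h) fun i hi => Finset.min'_le _ i hi).trans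
      (hη (mem_activeWindows.1 (Finset.min'_mem _ h)).1.le)

theorem norm_window_coeff_le {u : ℕ → ℂ} {L : ℝ} (hu : ∀ n, ‖u n‖ ≤ L) (n : ℕ) :
    ‖(1 / (η n : ℂ)) * starRingEnd ℂ (windowAverage u (η n) n)‖ ≤ L / η n := by
  rw [norm_mul, norm_div, norm_one, Complex.norm_natCast, RCLike.norm_conj, one_div,
    ← div_eq_inv_mul]
  gcongr
  exact norm_windowAverage_le hu _ _

/-- If `i` is the earliest active start, at most `η i` windows are active, and by monotonicity each
contributes at most `L / η i`. -/
theorem norm_windowSuperposition_le {u : ℕ → ℂ} {L : ℝ} (hu : ∀ n, ‖u n‖ ≤ L) (hη : Monotone η)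
    (hη1 : ∀ n, 1 ≤ η n) (m : ℕ) : ‖windowSuperposition u η m‖ ≤ L := by
  have hL : 0 ≤ L := (norm_nonneg _).trans (hu 0)
  rcases (activeWindows η m).eq_empty_or_nonempty with h | h
  · simpa [windowSuperposition, h] using hL
  set i := (activeWindows η m).min' h
  have hi : i ∈ activeWindows η m := Finset.min'_mem _ h
  have hmin : ∀ n ∈ activeWindows η m, i ≤ n := fun n hn => Finset.min'_le _ n hn
  have hpos : (0 : ℝ) < η i := by exact_mod_cast hη1 i
  calc _ ≤ ∑ n ∈ activeWindows η m, L / η i := by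
        refine norm_sum_le_of_le _ fun n hn => (norm_window_coeff_le hu n).trans ?_
        have : (η i : ℝ) ≤ η n := by exact_mod_cast hη (hmin n hn)
        gcongr
    _ = (activeWindows η m).card * (L / η i) := by rw [Finset.sum_const, nsmul_eq_mul]
    _ ≤ η i * (L / η i) := by
        have : ((activeWindows η m).card : ℝ) ≤ η i := by
          exact_mod_cast card_activeWindows_le hi hmin
        gcongr
    _ = L := by field_simp

/-- From `m` to `m + 1` one window opens and at most one closes, as the endpoints `n + η n` are
strictly increasing; each has a coefficient of size at most `L / η n`. -/
theorem tendsto_windowSuperposition_increment {u : ℕ → ℂ} {L : ℝ} (hu : ∀ n, ‖u n‖ ≤ L)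
    (hη : Monotone η) (hη1 : ∀ n, 1 ≤ η n) (hηt : Tendsto η atTop atTop) :
    Tendsto (fun m => ‖windowSuperposition u η (m + 1) - windowSuperposition u η m‖) atTop
      (𝓝 0) := by
  have hL : 0 ≤ L := (norm_nonneg _).trans (hu 0)
  have hsmall : Tendsto (fun n => L / (η n : ℝ)) atTop (𝓝 0) :=
    (tendsto_natCast_atTop_atTop.comp hηt).const_div_atTop L
  rw [Metric.tendsto_atTop]
  intro δ hδ
  obtain ⟨K, hK⟩ := eventually_atTop.1 (hsmall.eventually_lt_const (half_pos hδ))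
  -- Past this threshold a closing window must have started at `K` or later.
  refine ⟨K + η K, fun m hm => ?_⟩
  rw [dist_zero_right, norm_norm]
  set c : ℕ → ℂ := fun n => (1 / (η n : ℂ)) * starRingEnd ℂ (windowAverage u (η n) n)
  have hc : ∀ n, K ≤ n → ‖c n‖ < δ / 2 := fun n hn =>
    (norm_window_coeff_le hu n).trans_lt (hK n hn)
  set E : Finset ℕ := {n ∈ activeWindows η m | n + η n = m}
  have hnew : windowSuperposition u η (m + 1) =
      c m + ∑ n ∈ activeWindows η m with ¬ n + η n = m, c n := by
    have hm' : m ∉ {n ∈ activeWindows η m | ¬ n + η n = m} := by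
      simp [mem_activeWindows]
    rw [windowSuperposition, ← Finset.sum_insert hm']
    refine Finset.sum_congr ?_ fun _ _ => rfl
    ext n
    have := hη1 m
    simp only [mem_activeWindows, Finset.mem_insert, Finset.mem_filter]
    constructor
    · rintro ⟨h1, h2⟩
      by_cases h3 : n = m
      · exact Or.inl h3
      · exact Or.inr (by lia)
    · rintro (rfl | h)
      · lia
      · lia
  have hold : windowSuperposition u η m =
      ∑ n ∈ E, c n + ∑ n ∈ activeWindows η m with ¬ n + η n = m, c n :=
    (Finset.sum_filter_add_sum_filter_not _ _ _).symm
  have hE : ‖∑ n ∈ E, c n‖ ≤ δ / 2 := by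
    rcases E.eq_empty_or_nonempty with h | ⟨n, hn⟩
    · simpa [h] using (half_pos hδ).le
    have hinj : ∀ i j, i < j → i + η i < j + η j := fun i j hij =>
      add_lt_add_of_lt_of_le hij (hη hij.le)
    have hEn : E = {n} := by
      refine Finset.eq_singleton_iff_unique_mem.2 ⟨hn, fun i hi => ?_⟩
      have h1 := (Finset.mem_filter.1 hi).2
      have h2 := (Finset.mem_filter.1 hn).2
      rcases lt_trichotomy i n with h | h | h
      · exact absurd (hinj _ _ h) (by lia)
      · exact h
      · exact absurd (hinj _ _ h) (by lia)
    rw [hEn, Finset.sum_singleton]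
    refine (hc n ?_).le
    by_contra! h
    have h1 := hinj _ _ h
    have h2 := (Finset.mem_filter.1 hn).2
    lia
  calc _ = ‖c m - ∑ n ∈ E, c n‖ := by rw [hnew, hold]; congr 1; ring
    _ ≤ ‖c m‖ + ‖∑ n ∈ E, c n‖ := norm_sub_le _ _
    _ < δ / 2 + δ / 2 := add_lt_add_of_lt_of_le (hc m (by lia)) hE
    _ = δ := by ring

/-- After exchanging the sums, a complete window contributes exactly the squared modulus of its
average. Windows cut off by `N` are active at `N`, so there are at most `η N` of them, each costing
at most `2 * L ^ 2`. -/
theorem norm_sum_windowSuperposition_mul_sub_le {u : ℕ → ℂ} {L : ℝ} (hu : ∀ n, ‖u n‖ ≤ L)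
    (hη : Monotone η) (hη1 : ∀ n, 1 ≤ η n) (N : ℕ) :
    ‖∑ m ∈ Finset.Icc 1 N, windowSuperposition u η m * u m -
      ∑ n ∈ Finset.range N, ((‖windowAverage u (η n) n‖ ^ 2 : ℝ) : ℂ)‖ ≤ 2 * L ^ 2 * η N := by
  have hL : 0 ≤ L := (norm_nonneg _).trans (hu 0)
  set c : ℕ → ℂ := fun n => (1 / (η n : ℂ)) * starRingEnd ℂ (windowAverage u (η n) n)
  have hswap : ∑ m ∈ Finset.Icc 1 N, windowSuperposition u η m * u m =
      ∑ n ∈ Finset.range N, c n * ∑ m ∈ Finset.Ioc n (min N (n + η n)), u m := by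
    simp only [windowSuperposition, Finset.sum_mul, Finset.mul_sum]
    refine Finset.sum_comm' fun m n => ?_
    simp only [mem_activeWindows, Finset.mem_Icc, Finset.mem_range, Finset.mem_Ioc]
    lia
  have hpos : ∀ n, (0 : ℝ) < η n := fun n => by exact_mod_cast hη1 n
  have hfull : ∀ n, n + η n ≤ N → c n * ∑ m ∈ Finset.Ioc n (min N (n + η n)), u m =
      ((‖windowAverage u (η n) n‖ ^ 2 : ℝ) : ℂ) := by
    intro n hn
    have h0 : (η n : ℂ) ≠ 0 := by exact_mod_cast (hpos n).ne'
    have hsum : ∑ m ∈ Finset.Ioc n (min N (n + η n)), u m = η n * windowAverage u (η n) n := by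
      rw [min_eq_right hn, windowAverage, ← mul_assoc, mul_one_div_cancel h0, one_mul]
      have := Finset.image_add_left_Ioc 0 (η n) n
      rw [add_zero] at this
      rw [← this, Finset.sum_image fun a _ b _ hab => Nat.add_left_cancel hab]
      rfl
    rw [hsum, Complex.ofReal_pow, ← Complex.conj_mul']
    simp only [c]
    field_simp
  have hterm : ∀ n ∈ Finset.range N,
      ‖c n * ∑ m ∈ Finset.Ioc n (min N (n + η n)), u m -
        ((‖windowAverage u (η n) n‖ ^ 2 : ℝ) : ℂ)‖ ≤
      if n ∈ activeWindows η N then 2 * L ^ 2 else 0 := by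
    intro n hn
    rw [Finset.mem_range] at hn
    split_ifs with hact
    · have h1 : ‖∑ m ∈ Finset.Ioc n (min N (n + η n)), u m‖ ≤ η n * L := by
        refine (norm_sum_le_of_le _ fun m _ => hu m).trans ?_
        rw [Finset.sum_const, nsmul_eq_mul, Nat.card_Ioc]
        gcongr
        lia
      have h2 : ‖c n * ∑ m ∈ Finset.Ioc n (min N (n + η n)), u m‖ ≤ L ^ 2 := by
        rw [norm_mul]
        calc _ ≤ L / η n * (η n * L) :=
              mul_le_mul (norm_window_coeff_le hu n) h1 (norm_nonneg _) (by positivity)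
          _ = L ^ 2 := by have := (hpos n).ne'; field_simp
      have h3 : ‖((‖windowAverage u (η n) n‖ ^ 2 : ℝ) : ℂ)‖ ≤ L ^ 2 := by
        rw [Complex.norm_of_nonneg (sq_nonneg _)]
        exact pow_le_pow_left₀ (norm_nonneg _) (norm_windowAverage_le hu _ _) 2
      exact (norm_sub_le _ _).trans (by linarith)
    · rw [mem_activeWindows] at hact
      rw [hfull n (by lia), sub_self, norm_zero]
  rw [hswap, ← Finset.sum_sub_distrib]
  refine (norm_sum_le_of_le _ hterm).trans ?_
  rw [← Finset.sum_filter, Finset.sum_const, nsmul_eq_mul, mul_comm]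
  have h1 : {n ∈ Finset.range N | n ∈ activeWindows η N} ⊆ activeWindows η N := fun n hn =>
    (Finset.mem_filter.1 hn).2
  have h2 : (({n ∈ Finset.range N | n ∈ activeWindows η N} : Finset ℕ).card : ℝ) ≤ η N := by
    exact_mod_cast (Finset.card_le_card h1).trans (card_activeWindows_le_apply hη N)
  gcongr

end Smoothing

/-! ### From orthogonality to the short interval condition, and conclusion. -/

theorem shortIntervalCondition_of_orthogonalToClass {u : ℕ → ℂ}
    (hu : ∃ L : ℝ, ∀ n : ℕ, ‖u n‖ ≤ L) (h : OrthogonalToClass u classErgodicFixed) :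
    ShortIntervalCondition u := by
  by_contra hS
  simp only [ShortIntervalCondition, not_forall] at hS
  obtain ⟨ε, hε, N, hN, hH⟩ := hS
  push Not at hH
  have hlarge : ∀ H₀ : ℕ, ∃ H > H₀, ∀ M : ℕ, ∃ n ≥ M, ε < shortIntervalMean u H n := by
    intro H₀
    obtain ⟨H, hH1, hH2⟩ := hH (H₀ + 1) (by lia)
    refine ⟨H, by lia, fun M => ?_⟩
    obtain ⟨l, hl⟩ := hN.exists_tendsto_shortIntervalMean hu H
    obtain ⟨k, hk1, hk2⟩ := ((hl.eventually_const_lt (hH2 l hl)).and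
      (hN.1.tendsto_atTop.eventually_ge_atTop M)).exists
    exact ⟨N k, hk2, hk1⟩
  obtain ⟨L, hL⟩ := hu
  -- This `δ` gives `3 * L ^ 2 * η n ≤ ε / 4 * n`: two parts pay for the cut windows, one for the
  -- extra index `n`, as sums over `Icc 1 n` and `range n` are compared. With a correlation below `ε
  -- / 4 * n`, this contradicts the lower bound `ε / 2 * n`.
  obtain ⟨η, hη, hη1, hηt, hfreq⟩ := exists_window_scale hL hε
    (δ := ε / (12 * (L ^ 2 + 1))) (by positivity) hlarge
  have hlim := h.tendsto_of_increment ⟨L, norm_windowSuperposition_le hL hη hη1⟩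
    (tendsto_windowSuperposition_increment hL hη hη1 hηt)
  have hev := (NormedAddGroup.tendsto_nhds_zero.1 hlim) (ε / 4) (by positivity)
  obtain ⟨n, ⟨hn1, hn2⟩, hn3, hn0⟩ :=
    (hfreq.and_eventually (hev.and (eventually_gt_atTop 0))).exists
  have hn0' : (0 : ℝ) < n := by exact_mod_cast hn0
  rw [norm_mul, norm_div, norm_one, Complex.norm_natCast, one_div, ← div_eq_inv_mul,
    div_lt_iff₀ hn0'] at hn3
  have h1 := norm_sum_windowSuperposition_mul_sub_le hL hη hη1 n
  set P := ∑ m ∈ Finset.Icc 1 n, windowSuperposition u η m * u m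
  set Q := ∑ i ∈ Finset.range n, ‖windowAverage u (η i) i‖ ^ 2 with hQ
  have hQ0 : 0 ≤ Q := Finset.sum_nonneg fun _ _ => sq_nonneg _
  rw [← Complex.ofReal_sum, ← hQ] at h1
  have h2 : Q ≤ ‖P‖ + 2 * L ^ 2 * η n := by
    have := norm_le_norm_add_norm_sub P (Q : ℂ)
    rw [Complex.norm_of_nonneg hQ0] at this
    linarith
  have h3 : ∑ i ∈ Finset.Icc 1 n, ‖windowAverage u (η i) i‖ ^ 2 ≤ Q + L ^ 2 := by
    have hsub : Finset.Icc 1 n ⊆ Finset.range (n + 1) := fun i hi => by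
      simp at hi ⊢
      lia
    refine (Finset.sum_le_sum_of_subset_of_nonneg hsub fun _ _ _ => sq_nonneg _).trans ?_
    rw [Finset.sum_range_succ]
    gcongr
    exact norm_windowAverage_le hL _ _
  have h4 : (1 : ℝ) ≤ η n := by exact_mod_cast hη1 n
  have h5 : 3 * L ^ 2 * η n ≤ ε / 4 * n := by
    calc 3 * L ^ 2 * η n ≤ 3 * (L ^ 2 + 1) * (ε / (12 * (L ^ 2 + 1)) * n) := by
          gcongr
          linarith
      _ = ε / 4 * n := by
          have : (0 : ℝ) < L ^ 2 + 1 := by positivity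
          field_simp
          ring
  nlinarith [sq_nonneg L]

theorem mainTheorem8 (u : ℕ → ℂ) (hu : ∃ L : ℝ, ∀ n : ℕ, ‖u n‖ ≤ L) :
    (OrthogonalToClass u classID ↔ ShortIntervalCondition u) ∧
      (OrthogonalToClass u classErgodicFixed ↔ ShortIntervalCondition u) := by
  have h1 := orthogonalToClass_classID_of_shortIntervalCondition hu
  have h2 := shortIntervalCondition_of_orthogonalToClass hu
  have h3 : OrthogonalToClass u classID → OrthogonalToClass u classErgodicFixed :=
    fun h Y hY => h Y (classErgodicFixed_subset_classID hY)
  exact ⟨⟨h2 ∘ h3, h1⟩, ⟨h2, h3 ∘ h1⟩⟩
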